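/- **Proposition.** Let $\mathbb{K}=\mathbb{R}$ or $\mathbb{K}=\mathbb{C}$. Let $C([0,\omega_1])$ be the Banach space of continuous $\mathbb{K}$-valued functions, with the supremum norm, on the set $[0,\omega_1]$ of ordinals not exceeding the first uncountable ordinal $\omega_1$, equipped with the order topology, and let $c_0$ be the Banach space of $\mathbb{K}$-valued sequences converging to $0$, with the supremum norm. Write $\mathscr{B}(C([0,\omega_1]))$ for the Banach algebra of bounded linear operators on $C([0,\omega_1])$ with the operator norm, $\mathscr{K}(C([0,\omega_1]))$ for the set of compact operators in it, and $\overline{\mathscr{G}}_{c_0}(C([0,\omega_1]))$ for the operator-norm closure of the linear span of all compositions $VU$, where $U\colon C([0,\omega_1])\to c_0$ and $V\colon c_0\to C([0,\omega_1])$ are bounded linear operators. 1. The identity operator on $c_0$ factors through each non-compact bounded linear operator $T$ on $C([0,\omega_1])$; that is, there are bounded linear operators $R\colon c_0\to C([0,\omega_1])$ and $S\colon C([0,\omega_1])\to c_0$ such that $STR=I_{c_0}$. 2. Hence no closed two-sided ideal $\mathscr{I}$ of $\mathscr{B}(C([0,\omega_1]))$ lies strictly between $\mathscr{K}(C([0,\omega_1]))$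 and $\overline{\mathscr{G}}_{c_0}(C([0,\omega_1]))$; that is, none satisfies $\mathscr{K}(C([0,\omega_1]))\subsetneq\mathscr{I}\subsetneq\overline{\mathscr{G}}_{c_0}(C([0,\omega_1]))$. -/

import Mathlib

open scoped Ordinal ZeroAtInfty

/-- The compact ordinal interval `[0, ω₁]`, with the order topology. -/
abbrev OmegaOneInterval : Type 1 := Set.Icc (0 : Ordinal.{0}) ω₁

/-- The Banach space `C([0, ω₁])` of continuous `𝕜`-valued functions with the supremum norm. -/
abbrev COmegaOne (𝕜 : Type*) [RCLike 𝕜] := C(OmegaOneInterval, 𝕜)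

/-- The Banach space `c₀` of `𝕜`-valued null sequences with the supremum norm
(`ℕ` is discrete, so vanishing at infinity means tending to zero). -/
abbrev NullSeq (𝕜 : Type*) [RCLike 𝕜] := C₀(ℕ, 𝕜)

section Factorization

variable (𝕜 : Type*) [RCLike 𝕜]
  (Z : Type*) [NormedAddCommGroup Z] [NormedSpace 𝕜 Z]
  {X : Type*} [NormedAddCommGroup X] [NormedSpace 𝕜 X]
  {Y : Type*} [NormedAddCommGroup Y] [NormedSpace 𝕜 Y]

/-- The identity operator on `Z` factors through `T : X → Y`: there are bounded operators
`R : Z → X` and `S : Y → Z` with `S T R = I`. -/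
def IdFactorsThrough (T : X →L[𝕜] Y) : Prop :=
  ∃ (R : Z →L[𝕜] X) (S : Y →L[𝕜] Z), S ∘L T ∘L R = ContinuousLinearMap.id 𝕜 Z

variable (X Y) in
/-- `𝒢_Z(X, Y)`: the linear span of the operators `X → Y` that factor through `Z`. -/
def factorIdeal : Submodule 𝕜 (X →L[𝕜] Y) :=
  Submodule.span 𝕜 {U | ∃ (S : X →L[𝕜] Z) (T : Z →L[𝕜] Y), U = T ∘L S}

variable (X Y) in
/-- The operator-norm closure of `𝒢_Z(X, Y)`. -/
def closedFactorIdeal : Submodule 𝕜 (X →L[𝕜] Y) :=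
  (factorIdeal 𝕜 Z X Y).topologicalClosure

end Factorization

section

open Filter Topology Set

/-! ### Topology of compact well-ordered spaces -/

section WellOrder

variable {K : Type*} [LinearOrder K] [WellFoundedLT K] [TopologicalSpace K] [OrderTopology K]

/-! Only compactness and well-ordering of `[0, ω₁]` matter. If `T` is small on functions supported
in short intervals just below each point, transfinite induction on initial segments makes `T` a
limit of compact operators. So a non-compact `T` admits disjointly supported `f n` in the unit ball
with `‖T (f n)‖ > ε` (`exists_disjointlySupported_of_not_isCompactOperator`).

Such `f n` are weakly null and span a copy of `c₀` boundedly. Choose `p n` where `T (f n)` is large;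
along a subsequence `p n → q`, and `ev (p n) - ev q` is weak-* null. The matrix of these functionals
against `T (f j)` has null rows and columns and a diagonal bounded below. Thinned out and
normalised, it is a small perturbation of the identity of `c₀`, hence invertible
(`DisjointlySupported.idFactorsThrough`).

The ideal statement follows from `V U = V (S T R) U`. -/

theorem isClopen_Iic_of_wellFoundedLT (a : K) : IsClopen (Iic a) := by
  refine ⟨isClosed_Iic, ?_⟩
  rcases (Ioi a).eq_empty_or_nonempty with h | h
  · have : Iic a = univ := by rw [← compl_Ioi, h, compl_empty]
    rw [this]; exact isOpen_univ
  · have : Iic a = Iio (wellFounded_lt.min (Ioi a) h) := by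
      ext x
      refine ⟨fun hx => lt_of_le_of_lt hx (wellFounded_lt.min_mem (Ioi a) h), fun hx => ?_⟩
      by_contra hxa
      exact wellFounded_lt.not_lt_min (Ioi a) (not_le.mp hxa) hx
    rw [this]; exact isOpen_Iio

/-- A well-order has no strictly decreasing sequence, so Ramsey yields a monotone subsequence, which
converges to its supremum. -/
theorem exists_strictMono_tendsto_of_wellFoundedLT [CompactSpace K] (u : ℕ → K) :
    ∃ (p : K) (φ : ℕ → ℕ), StrictMono φ ∧ Tendsto (u ∘ φ) atTop (𝓝 p) := by
  have : Nonempty K := ⟨u 0⟩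
  obtain ⟨t, -, ht⟩ := (isCompact_univ (X := K)).exists_isGreatest univ_nonempty
  obtain ⟨g, hg⟩ := exists_increasing_or_nonincreasing_subseq (α := K) (· > ·) u
  have hmono : Monotone (u ∘ g) := by
    rcases hg with hg | hg
    · exact (not_strictAnti_of_wellFoundedLT (u ∘ g) fun m n hmn => hg m n hmn).elim
    · intro m n hmn
      rcases hmn.eq_or_lt with rfl | h
      · exact le_rfl
      · exact not_lt.mp (hg m n h)
  have hne : (upperBounds (range (u ∘ g))).Nonempty := ⟨t, fun x _ => ht (mem_univ x)⟩
  exact ⟨_, g, g.strictMono, tendsto_atTop_isLUB hmono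
    ⟨wellFounded_lt.min_mem _ hne, fun x hx => not_lt.mp (wellFounded_lt.not_lt_min _ hx)⟩⟩

end WellOrder

/-- At each point at most one member of the family `f` does not vanish. -/
def DisjointlySupported {ι α M : Type*} [TopologicalSpace α] [TopologicalSpace M] [Zero M]
    (f : ι → C(α, M)) : Prop :=
  ∀ i j, i ≠ j → ∀ x, f i x = 0 ∨ f j x = 0

/-! ### Non-compactness produces disjoint supports -/

section Compactness

variable {𝕜 : Type*} [RCLike 𝕜] {K : Type*} [LinearOrder K] [WellFoundedLT K]
  [TopologicalSpace K] [OrderTopology K]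
  {Y : Type*} [NormedAddCommGroup Y] [NormedSpace 𝕜 Y]

variable (𝕜) in
/-- The indicator function of the initial segment `Iic a`. -/
noncomputable def iicIndicator (a : K) : C(K, 𝕜) :=
  (LocallyConstant.charFn 𝕜 (isClopen_Iic_of_wellFoundedLT a) : C(K, 𝕜))

theorem iicIndicator_of_le {a x : K} (h : x ≤ a) : iicIndicator 𝕜 a x = 1 := by
  simp [iicIndicator, LocallyConstant.coe_charFn, h]

theorem iicIndicator_of_lt {a x : K} (h : a < x) : iicIndicator 𝕜 a x = 0 := by
  simp [iicIndicator, LocallyConstant.coe_charFn, h]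

variable [CompactSpace K]

variable (𝕜) in
/-- The operator of multiplication by the indicator function of `Iic a`. -/
noncomputable def iicProj (a : K) : C(K, 𝕜) →L[𝕜] C(K, 𝕜) :=
  ContinuousLinearMap.mul 𝕜 C(K, 𝕜) (iicIndicator 𝕜 a)

theorem iicProj_of_le {a x : K} (f : C(K, 𝕜)) (h : x ≤ a) : iicProj 𝕜 a f x = f x := by
  simp [iicProj, iicIndicator_of_le h]

theorem iicProj_of_lt {a x : K} (f : C(K, 𝕜)) (h : a < x) : iicProj 𝕜 a f x = 0 := by
  simp [iicProj, iicIndicator_of_lt h]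

theorem norm_iicProj_apply_le (a : K) (f : C(K, 𝕜)) : ‖iicProj 𝕜 a f‖ ≤ ‖f‖ := by
  refine (ContinuousMap.norm_le _ (norm_nonneg f)).2 fun x => ?_
  rcases le_or_gt x a with h | h
  · rw [iicProj_of_le f h]; exact f.norm_coe_le_norm x
  · rw [iicProj_of_lt f h]; simp

/-- A function vanishing outside `Iio a` is a norm limit of its restrictions to `Iic b`, `b < a`. -/
theorem exists_lt_iicProj_mem {a b₀ : K} (hb₀ : b₀ < a) {f : C(K, 𝕜)}
    (hf : ∀ x, a ≤ x → f x = 0) {V : Set C(K, 𝕜)} (hV : V ∈ 𝓝 f) :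
    ∃ b < a, iicProj 𝕜 b f ∈ V := by
  obtain ⟨δ, hδ, hball⟩ := Metric.nhds_basis_closedBall.mem_iff.1 hV
  have hnhds : {x | ‖f x‖ ≤ δ} ∈ 𝓝 a := by
    have h0 := f.continuous.norm.tendsto a
    rw [hf a le_rfl, norm_zero] at h0
    exact (h0.eventually_lt_const hδ).mono fun x hx => hx.le
  obtain ⟨b, hb, hsub⟩ := exists_Ioc_subset_of_mem_nhds hnhds ⟨b₀, hb₀⟩
  refine ⟨b, hb, hball ?_⟩
  rw [mem_closedBall_iff_norm, ContinuousMap.norm_le _ hδ.le]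
  intro x
  rw [ContinuousMap.sub_apply]
  rcases le_or_gt x b with h | h
  · simp [iicProj_of_le f h, hδ.le]
  · rw [iicProj_of_lt f h, zero_sub, norm_neg]
    rcases le_or_gt x a with h' | h'
    · exact hsub ⟨h, h'⟩
    · simp [hf x h'.le, hδ.le]

/-- A gliding hump towards `a`: each new function is supported beyond all earlier ones, then
truncated strictly below `a` to leave room for the next. -/
theorem exists_disjointlySupported_of_forall_lt (U : C(K, 𝕜) →L[𝕜] Y) {a b₀ : K} (hb₀ : b₀ < a)
    {ε : ℝ} (h : ∀ b < a, ∃ f : C(K, 𝕜), ‖f‖ ≤ 1 ∧ (∀ x, x ≤ b ∨ a ≤ x → f x = 0) ∧ ε < ‖U f‖) :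
    ∃ f : ℕ → C(K, 𝕜), (∀ n, ‖f n‖ ≤ 1) ∧ DisjointlySupported f ∧ ∀ n, ε < ‖U (f n)‖ := by
  obtain ⟨F, hP, hr⟩ := exists_seq_of_forall_finset_exists (α := K × C(K, 𝕜))
    (fun y => y.1 < a ∧ ‖y.2‖ ≤ 1 ∧ (∀ x, y.1 < x → y.2 x = 0) ∧ ε < ‖U y.2‖)
    (fun y z => ∀ x ≤ y.1, z.2 x = 0) (by
      intro s hs
      obtain ⟨b, hba, hb⟩ : ∃ b < a, ∀ y ∈ s, y.1 ≤ b := by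
        rcases s.eq_empty_or_nonempty with rfl | hne
        · exact ⟨b₀, hb₀, by simp⟩
        · obtain ⟨y, hy, hmax⟩ := s.exists_max_image Prod.fst hne
          exact ⟨y.1, (hs y hy).1, hmax⟩
      obtain ⟨f, hf1, hf0, hfU⟩ := h b hba
      obtain ⟨c, hc, hcU⟩ := exists_lt_iicProj_mem hb₀ (fun x hx => hf0 x (Or.inr hx))
        ((U.continuous.norm.isOpen_preimage _ isOpen_Ioi).mem_nhds (show ‖U f‖ ∈ Ioi ε from hfU))
      refine ⟨(c, iicProj 𝕜 c f), ⟨hc, (norm_iicProj_apply_le c f).trans hf1,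
        fun x hx => iicProj_of_lt f hx, hcU⟩, fun y hy x hx => ?_⟩
      rcases le_or_gt x c with hxc | hxc
      · exact (iicProj_of_le f hxc).trans (hf0 x (Or.inl (hx.trans (hb y hy))))
      · exact iicProj_of_lt f hxc)
  have key : ∀ m n, m < n → ∀ x, (F m).2 x = 0 ∨ (F n).2 x = 0 := fun m n hmn x => by
    rcases le_or_gt x (F m).1 with hx | hx
    · exact Or.inr (hr m n hmn x hx)
    · exact Or.inl ((hP m).2.2.1 x hx)
  refine ⟨fun n => (F n).2, fun n => (hP n).2.1, fun m n hmn x => ?_, fun n => (hP n).2.2.2⟩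
  rcases hmn.lt_or_gt with h | h
  · exact key m n h x
  · exact (key n m h x).symm

theorem isCompactOperator_smulRight {X : Type*} [NormedAddCommGroup X] [NormedSpace 𝕜 X]
    (φ : X →L[𝕜] 𝕜) (y : Y) : IsCompactOperator (φ.smulRight y) :=
  IsCompactOperator.comp_clm (f := ContinuousLinearMap.toSpanSingleton 𝕜 y)
    (isCompactOperator_of_locallyCompactSpace_rng _) φ

/-- A non-compact operator on `C(K)`, `K` compact and well-ordered, is bounded away from zero along
some disjointly supported sequence in the unit ball. -/
theorem exists_disjointlySupported_of_not_isCompactOperator [CompleteSpace Y]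
    (U : C(K, 𝕜) →L[𝕜] Y) (hU : ¬ IsCompactOperator U) :
    ∃ ε > 0, ∃ f : ℕ → C(K, 𝕜),
      (∀ n, ‖f n‖ ≤ 1) ∧ DisjointlySupported f ∧ ∀ n, ε < ‖U (f n)‖ := by
  by_contra hcon
  apply hU
  have hsmall : ∀ a b₀ : K, b₀ < a → ∀ ε > 0, ∃ b < a, ∀ f : C(K, 𝕜), ‖f‖ ≤ 1 →
      (∀ x, x ≤ b ∨ a ≤ x → f x = 0) → ‖U f‖ ≤ ε := by
    intro a b₀ hb₀ ε hε
    by_contra! h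
    exact hcon ⟨ε, hε, exists_disjointlySupported_of_forall_lt U hb₀ h⟩
  have main : ∀ a : K, IsCompactOperator (U ∘L iicProj 𝕜 a) := by
    intro a
    induction a using WellFoundedLT.induction with
    | _ a ih =>
    by_cases hbot : ∀ b, a ≤ b
    -- At the bottom point `Iic a` is `{a}`, so the operator has rank at most one.
    · have : U ∘L iicProj 𝕜 a = (ContinuousMap.evalCLM 𝕜 a).smulRight (U (iicIndicator 𝕜 a)) := by
        ext f
        simp only [ContinuousLinearMap.comp_apply, ContinuousLinearMap.smulRight_apply,
          ← map_smul]
        congr 1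
        ext x
        rcases (hbot x).eq_or_lt with rfl | h
        · simp [iicProj_of_le, iicIndicator_of_le]
        · simp [iicProj_of_lt _ h, iicIndicator_of_lt h]
      rw [this]
      exact isCompactOperator_smulRight _ _
    push Not at hbot
    obtain ⟨b₀, hb₀⟩ := hbot
    refine isClosed_setOfPred_isCompactOperator.closure_subset (Metric.mem_closure_iff.2 ?_)
    intro ε hε
    obtain ⟨b, hb, hbU⟩ := hsmall a b₀ hb₀ (ε / 4) (by positivity)
    -- On `Iic a`, `f` is its part on `Iic b`, plus the constant `f a` on `(b, a]`, plus a remainder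
    -- `g` supported in `(b, a)`. As `‖g‖ ≤ 2`, the bound `ε / 4` leaves an error of `ε / 2`.
    refine ⟨U ∘L iicProj 𝕜 b + (ContinuousMap.evalCLM 𝕜 a).smulRight
      (U (iicIndicator 𝕜 a - iicIndicator 𝕜 b)),
      (ih b hb).add (isCompactOperator_smulRight _ _), ?_⟩
    rw [dist_eq_norm]
    refine lt_of_le_of_lt
      (ContinuousLinearMap.opNorm_le_of_unit_norm (𝕜 := 𝕜) (C := ε / 2) (by positivity) ?_)
      (half_lt_self hε)
    intro f hf
    set g : C(K, 𝕜) := iicProj 𝕜 a f - iicProj 𝕜 b f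
      - f a • (iicIndicator 𝕜 a - iicIndicator 𝕜 b) with hg
    have hUg : (U ∘L iicProj 𝕜 a - (U ∘L iicProj 𝕜 b +
      (ContinuousMap.evalCLM 𝕜 a : C(K, 𝕜) →L[𝕜] 𝕜).smulRight
        (U (iicIndicator 𝕜 a - iicIndicator 𝕜 b)))) f = (2 : 𝕜) • U ((2⁻¹ : 𝕜) • g) := by
      rw [map_smul, smul_smul, mul_inv_cancel₀ two_ne_zero, one_smul]
      simp only [hg, map_sub, map_smul, sub_apply,
        add_apply, ContinuousLinearMap.comp_apply,
        ContinuousLinearMap.smulRight_apply, ContinuousMap.evalCLM_apply]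
      abel
    have hg0 : ∀ x, x ≤ b ∨ a ≤ x → g x = 0 := by
      rintro x (hx | hx)
      · simp [hg, iicProj_of_le f hx, iicProj_of_le f (hx.trans hb.le), iicIndicator_of_le hx,
          iicIndicator_of_le (hx.trans hb.le)]
      · rcases hx.eq_or_lt with rfl | hx
        · simp [hg, iicProj_of_le f le_rfl, iicProj_of_lt f hb, iicIndicator_of_le le_rfl,
            iicIndicator_of_lt hb]
        · simp [hg, iicProj_of_lt f hx, iicProj_of_lt f (hb.trans hx), iicIndicator_of_lt hx,
            iicIndicator_of_lt (hb.trans hx)]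
    have hg1 : ‖(2⁻¹ : 𝕜) • g‖ ≤ 1 := by
      refine (ContinuousMap.norm_le _ zero_le_one).2 fun x => ?_
      by_cases hx : x ≤ b ∨ a ≤ x
      · simp [hg0 x hx]
      · push Not at hx
        have : g x = f x - f a := by
          simp [hg, iicProj_of_le f hx.2.le, iicProj_of_lt f hx.1, iicIndicator_of_le hx.2.le,
            iicIndicator_of_lt hx.1]
        have h2 : ‖f x - f a‖ ≤ 1 + 1 := (norm_sub_le _ _).trans
          (add_le_add ((f.norm_coe_le_norm x).trans hf.le) ((f.norm_coe_le_norm a).trans hf.le))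
        rw [ContinuousMap.smul_apply, this, norm_smul, norm_inv, RCLike.norm_two]
        linarith
    have := hbU _ hg1 fun x hx => by simp [hg0 x hx]
    rw [hUg, norm_smul, RCLike.norm_two]
    linarith
  rcases isEmpty_or_nonempty K with hK | hK
  · have : U = 0 := by
      ext f
      rw [show f = 0 from ContinuousMap.ext fun x => hK.elim x]
      simp
    rw [this]
    exact isCompactOperator_zero
  · obtain ⟨t, -, ht⟩ := (isCompact_univ (X := K)).exists_isGreatest univ_nonempty
    convert main t using 1
    ext f
    have : iicProj 𝕜 t f = f := ContinuousMap.ext fun x => iicProj_of_le f (ht (mem_univ x))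
    simp [this]

end Compactness

/-! ### Operators into `c₀` and thinning of matrices -/

section NullSequences

variable {𝕜 : Type*} [RCLike 𝕜]

theorem tendsto_nullSeq (x : NullSeq 𝕜) : Tendsto x atTop (𝓝 0) := by
  have := x.zero_at_infty'
  rwa [cocompact_eq_cofinite, Nat.cofinite_eq_atTop] at this

theorem norm_nullSeq_apply_le (x : NullSeq 𝕜) (n : ℕ) : ‖x n‖ ≤ ‖x‖ :=
  x.toBCF.norm_coe_le_norm n

theorem norm_nullSeq_le {x : NullSeq 𝕜} {C : ℝ} (hC : 0 ≤ C) (h : ∀ n, ‖x n‖ ≤ C) : ‖x‖ ≤ C :=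
  (BoundedContinuousFunction.norm_le hC).2 h

/-- A bounded weak-* null sequence of functionals defines an operator into `c₀`. -/
theorem exists_clm_nullSeq_of_tendsto_zero {Y : Type*} [NormedAddCommGroup Y] [NormedSpace 𝕜 Y]
    (ν : ℕ → Y →L[𝕜] 𝕜) {M : ℝ} (hM : ∀ n, ‖ν n‖ ≤ M)
    (hν : ∀ y, Tendsto (fun n => ν n y) atTop (𝓝 0)) :
    ∃ S : Y →L[𝕜] NullSeq 𝕜, ∀ y n, S y n = ν n y := by
  let S : Y →ₗ[𝕜] NullSeq 𝕜 :=
    { toFun := fun y => ⟨⟨fun n => ν n y, continuous_of_discreteTopology⟩, by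
        rw [cocompact_eq_cofinite, Nat.cofinite_eq_atTop]; exact hν y⟩
      map_add' := fun y z => by ext n; exact map_add (ν n) y z
      map_smul' := fun c y => by ext n; exact map_smul (ν n) c y }
  have hM0 : 0 ≤ M := (norm_nonneg _).trans (hM 0)
  exact ⟨S.mkContinuous M fun y => norm_nullSeq_le (mul_nonneg hM0 (norm_nonneg y)) fun n =>
    (ν n).le_of_opNorm_le (hM n) y, fun y n => rfl⟩

theorem exists_strictMono_offDiagonal_le (a : ℕ → ℕ → ℝ)
    (h₁ : ∀ j, Tendsto (fun n => a n j) atTop (𝓝 0))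
    (h₂ : ∀ n, Tendsto (fun j => a n j) atTop (𝓝 0)) (δ : ℕ → ℝ) (hδ : ∀ n, 0 < δ n)
    (hδa : Antitone δ) :
    ∃ φ : ℕ → ℕ, StrictMono φ ∧ ∀ k j, k ≠ j → a (φ k) (φ j) ≤ δ j := by
  -- The first coordinate is a strictly increasing counter, hence at least the position in the
  -- sequence; antitonicity of `δ` then turns bounds at the counter into bounds at the position.
  obtain ⟨F, -, hr⟩ := exists_seq_of_forall_finset_exists (α := ℕ × ℕ) (fun _ => True)
    (fun y z => y.1 < z.1 ∧ y.2 < z.2 ∧ a z.2 y.2 ≤ δ y.1 ∧ a y.2 z.2 ≤ δ z.1) (by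
      intro s _
      set i := s.sup Prod.fst + 1
      have hev : ∀ᶠ n in atTop, ∀ y ∈ s, y.2 < n ∧ a n y.2 ≤ δ y.1 ∧ a y.2 n ≤ δ i := by
        refine (s.eventually_all).2 fun y _ => ?_
        filter_upwards [eventually_gt_atTop y.2, (h₁ y.2).eventually_lt_const (hδ y.1),
          (h₂ y.2).eventually_lt_const (hδ i)] with n hn hn₁ hn₂
        exact ⟨hn, hn₁.le, hn₂.le⟩
      obtain ⟨n, hn⟩ := hev.exists
      exact ⟨(i, n), trivial, fun y hy =>
        ⟨Nat.lt_succ_of_le (Finset.le_sup (f := Prod.fst) hy), hn y hy⟩⟩)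
  have hidx : ∀ k, k ≤ (F k).1 := fun k => StrictMono.le_apply
    (f := fun k => (F k).1) (fun m n hmn => (hr m n hmn).1)
  refine ⟨fun k => (F k).2, fun m n hmn => (hr m n hmn).2.1, fun k j hkj => ?_⟩
  rcases hkj.lt_or_gt with h | h
  · exact (hr k j h).2.2.2.trans (hδa (hidx j))
  · exact (hr j k h).2.2.1.trans (hδa (hidx j))

end NullSequences

/-! ### Disjointly supported sequences as copies of the `c₀` basis -/

section DisjointlySupported

variable {𝕜 : Type*} [RCLike 𝕜] {K : Type*} [TopologicalSpace K] [CompactSpace K]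

theorem DisjointlySupported.norm_sum_smul_le {ι : Type*} {f : ι → C(K, 𝕜)}
    (hd : DisjointlySupported f)
    (hf : ∀ n, ‖f n‖ ≤ 1) (s : Finset ι) (c : ι → 𝕜) {C : ℝ} (hC : 0 ≤ C)
    (hc : ∀ k ∈ s, ‖c k‖ ≤ C) : ‖∑ k ∈ s, c k • f k‖ ≤ C := by
  refine (ContinuousMap.norm_le _ hC).2 fun x => ?_
  rw [ContinuousMap.sum_apply]
  simp only [ContinuousMap.smul_apply]
  by_cases h : ∃ i ∈ s, f i x ≠ 0
  · obtain ⟨i, hi, hix⟩ := h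
    rw [Finset.sum_eq_single_of_mem i hi fun j _ hji => by
      rw [(hd j i hji x).resolve_right hix, smul_zero], norm_smul]
    calc ‖c i‖ * ‖f i x‖ ≤ C * 1 := mul_le_mul (hc i hi)
          (((f i).norm_coe_le_norm x).trans (hf i)) (norm_nonneg _) hC
      _ = C := mul_one C
  · push Not at h
    rw [Finset.sum_eq_zero fun i hi => by rw [h i hi, smul_zero], norm_zero]
    exact hC

/-- Unimodular combinations of the `f n` have norm at most one, so `∑ ‖ψ (f n)‖ ≤ ‖ψ‖`. -/
theorem DisjointlySupported.tendsto_functional {f : ℕ → C(K, 𝕜)} (hd : DisjointlySupported f)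
    (hf : ∀ n, ‖f n‖ ≤ 1) (ψ : C(K, 𝕜) →L[𝕜] 𝕜) : Tendsto (fun n => ψ (f n)) atTop (𝓝 0) := by
  choose c hc1 hc using fun n => RCLike.exists_norm_eq_mul_self (ψ (f n))
  refine tendsto_zero_iff_norm_tendsto_zero.2 (Summable.tendsto_atTop_zero
    (summable_of_sum_le (c := ‖ψ‖) (fun n => norm_nonneg _) fun s => ?_))
  have h := ψ.le_opNorm_of_le (hd.norm_sum_smul_le hf s c zero_le_one fun k _ => (hc1 k).le)
  rw [map_sum, mul_one] at h
  have h2 : ∑ k ∈ s, ψ (c k • f k) = ((∑ k ∈ s, ‖ψ (f k)‖ : ℝ) : 𝕜) := by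
    push_cast
    exact Finset.sum_congr rfl fun k _ => by
      rw [map_smul, smul_eq_mul]; exact (hc k).symm
  rw [h2, RCLike.norm_ofReal] at h
  exact (le_abs_self _).trans h

theorem DisjointlySupported.summable_smul {f : ℕ → C(K, 𝕜)} (hd : DisjointlySupported f)
    (hf : ∀ n, ‖f n‖ ≤ 1) (x : NullSeq 𝕜) : Summable fun n => x n • f n := by
  refine summable_iff_vanishing_norm.2 fun ε hε => ?_
  have hev := (tendsto_zero_iff_norm_tendsto_zero.1 (tendsto_nullSeq x)).eventually_lt_const
    (half_pos hε)
  obtain ⟨N, hN⟩ := eventually_atTop.1 hev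
  refine ⟨Finset.range N, fun t ht => lt_of_le_of_lt
    (hd.norm_sum_smul_le hf t x (half_pos hε).le fun k hk => (hN k ?_).le) (half_lt_self hε)⟩
  by_contra hk'
  exact Finset.disjoint_left.1 ht hk (Finset.mem_range.2 (not_le.1 hk'))

theorem DisjointlySupported.exists_clm {f : ℕ → C(K, 𝕜)} (hd : DisjointlySupported f)
    (hf : ∀ n, ‖f n‖ ≤ 1) :
    ∃ R : NullSeq 𝕜 →L[𝕜] C(K, 𝕜), ∀ x : NullSeq 𝕜, HasSum (fun n => x n • f n) (R x) := by
  have hs := hd.summable_smul hf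
  let R : NullSeq 𝕜 →ₗ[𝕜] C(K, 𝕜) :=
    { toFun := fun x => ∑' n, x n • f n
      map_add' := fun x y => by
        rw [← (hs x).tsum_add (hs y)]
        exact tsum_congr fun n => add_smul _ _ _
      map_smul' := fun c x => by
        rw [RingHom.id_apply, ← (hs x).tsum_const_smul c]
        exact tsum_congr fun n => mul_smul _ _ _ }
  refine ⟨R.mkContinuous 1 fun x => ?_, fun x => (hs x).hasSum⟩
  rw [one_mul]
  exact le_of_tendsto (hs x).hasSum.norm (Eventually.of_forall fun s =>
    hd.norm_sum_smul_le hf s x (norm_nonneg x) fun k _ => norm_nullSeq_apply_le x k)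

/-- If bounded weak-* null functionals stay away from zero along the image of a disjointly
supported bounded sequence, then the identity of `c₀` factors through the operator. -/
theorem DisjointlySupported.idFactorsThrough {f : ℕ → C(K, 𝕜)} (hd : DisjointlySupported f)
    (hf : ∀ n, ‖f n‖ ≤ 1) {Y : Type*} [NormedAddCommGroup Y] [NormedSpace 𝕜 Y]
    (T : C(K, 𝕜) →L[𝕜] Y) (ν : ℕ → Y →L[𝕜] 𝕜) {M : ℝ} (hM : ∀ n, ‖ν n‖ ≤ M)
    (hν : ∀ y, Tendsto (fun n => ν n y) atTop (𝓝 0)) {c : ℝ} (hc : 0 < c)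
    (hdiag : ∀ n, c ≤ ‖ν n (T (f n))‖) : IdFactorsThrough 𝕜 (NullSeq 𝕜) T := by
  -- After division by diagonal entries of size at least `c`, the off-diagonal errors in each row
  -- sum to at most `∑ (1/2)^j / 4 = 1/2`.
  let δ : ℕ → ℝ := fun j => c * ((1 / 2) ^ j / 4)
  obtain ⟨φ, hφ, hoff⟩ := exists_strictMono_offDiagonal_le (fun n j => ‖ν n (T (f j))‖)
    (fun j => tendsto_zero_iff_norm_tendsto_zero.1 (hν _))
    (fun n => tendsto_zero_iff_norm_tendsto_zero.1 (hd.tendsto_functional hf (ν n ∘L T)))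
    δ (fun n => by positivity) (fun m n hmn => mul_le_mul_of_nonneg_left
      (div_le_div_of_nonneg_right (pow_le_pow_of_le_one (by norm_num) (by norm_num) hmn)
        (by norm_num)) hc.le)
  set d : ℕ → 𝕜 := fun k => ν (φ k) (T (f (φ k)))
  have hd0 : ∀ k, d k ≠ 0 := fun k => norm_pos_iff.1 (hc.trans_le (hdiag _))
  have hdinv : ∀ k, ‖(d k)⁻¹‖ ≤ c⁻¹ := fun k => by
    rw [norm_inv]; exact inv_anti₀ hc (hdiag _)
  obtain ⟨S, hS⟩ := exists_clm_nullSeq_of_tendsto_zero (fun k => (d k)⁻¹ • ν (φ k))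
    (M := c⁻¹ * M)
    (fun k => by
      rw [norm_smul]
      exact mul_le_mul (hdinv k) (hM _) (norm_nonneg _) (inv_nonneg.2 hc.le))
    (fun y => by
      have h := (hν y).comp hφ.tendsto_atTop
      refine squeeze_zero_norm (a := fun k => c⁻¹ * ‖ν (φ k) y‖) (fun k => ?_) ?_
      · rw [_root_.smul_apply, norm_smul]
        exact mul_le_mul_of_nonneg_right (hdinv k) (norm_nonneg _)
      · simpa using (tendsto_zero_iff_norm_tendsto_zero.1 h).const_mul c⁻¹)
  have hd' : DisjointlySupported (f ∘ φ) := fun i j hij => hd _ _ (hφ.injective.ne hij)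
  obtain ⟨R, hR⟩ := hd'.exists_clm fun n => hf _
  set A : NullSeq 𝕜 →L[𝕜] NullSeq 𝕜 := S ∘L T ∘L R with hA
  have hgeom : HasSum (fun j : ℕ => ((1 : ℝ) / 2) ^ j / 4) (2 / 4) :=
    hasSum_geometric_two.div_const 4
  have hnorm : ‖ContinuousLinearMap.id 𝕜 (NullSeq 𝕜) - A‖ ≤ 1 / 2 := by
    refine ContinuousLinearMap.opNorm_le_bound _ (by norm_num) fun x => ?_
    refine norm_nullSeq_le (by positivity) fun k => ?_
    have hsum : HasSum (fun j => (d k)⁻¹ * (x j * ν (φ k) (T (f (φ j))))) (A x k) := by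
      have h := ((hR x).mapL ((d k)⁻¹ • (ν (φ k) ∘L T)))
      simpa [hA, hS, mul_left_comm] using h
    have hsingle : HasSum (fun j => if j = k then x k else 0) (x k) := hasSum_ite_eq k (x k)
    have hdiff := hsingle.sub hsum
    have hle : ∀ j, ‖(if j = k then x k else 0) - (d k)⁻¹ * (x j * ν (φ k) (T (f (φ j))))‖ ≤
        ‖x‖ * ((1 / 2) ^ j / 4) := by
      intro j
      by_cases hjk : j = k
      · subst hjk
        have : (d j)⁻¹ * (x j * ν (φ j) (T (f (φ j)))) = x j := by
          change (d j)⁻¹ * (x j * d j) = x j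
          field_simp [hd0 j]
        rw [if_pos rfl, this, sub_self, norm_zero]
        positivity
      · rw [if_neg hjk, zero_sub, norm_neg, norm_mul, norm_mul]
        calc ‖(d k)⁻¹‖ * (‖x j‖ * ‖ν (φ k) (T (f (φ j)))‖)
            ≤ c⁻¹ * (‖x‖ * (c * ((1 / 2) ^ j / 4))) := by
              gcongr
              · exact hdinv k
              · exact norm_nullSeq_apply_le x j
              · exact hoff k j (Ne.symm hjk)
          _ = ‖x‖ * ((1 / 2) ^ j / 4) := by field_simp
    have := hdiff.norm_le_of_bounded (hgeom.mul_left ‖x‖) hle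
    calc ‖(ContinuousLinearMap.id 𝕜 (NullSeq 𝕜) - A) x k‖ = ‖x k - A x k‖ := rfl
      _ ≤ ‖x‖ * (2 / 4) := this
      _ = 1 / 2 * ‖x‖ := by ring
  -- Neumann series: `A` is within `1/2` of the identity, and its inverse is absorbed into `S`.
  have hunit : IsUnit A := by
    have hA1 : A = 1 - (ContinuousLinearMap.id 𝕜 (NullSeq 𝕜) - A) := by ext x n; simp
    rw [hA1]
    have hlt : ‖ContinuousLinearMap.id 𝕜 (NullSeq 𝕜) - A‖ < 1 := hnorm.trans_lt one_half_lt_one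
    exact isUnit_one_sub_of_norm_lt_one (R := NullSeq 𝕜 →L[𝕜] NullSeq 𝕜) hlt
  obtain ⟨B, hB⟩ := hunit.exists_left_inv
  exact ⟨R, B ∘L S, hB⟩

end DisjointlySupported

/-- The identity of `c₀` factors through each non-compact operator on `C(K)`, `K` a compact
well-ordered space. -/
theorem idFactorsThrough_nullSeq_of_not_isCompactOperator {𝕜 : Type*} [RCLike 𝕜] {K : Type*}
    [LinearOrder K] [WellFoundedLT K] [TopologicalSpace K] [OrderTopology K] [CompactSpace K]
    (T : C(K, 𝕜) →L[𝕜] C(K, 𝕜)) (hT : ¬ IsCompactOperator T) :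
    IdFactorsThrough 𝕜 (NullSeq 𝕜) T := by
  obtain ⟨ε, hε, f, hf, hd, hfT⟩ := exists_disjointlySupported_of_not_isCompactOperator T hT
  have hpt : ∀ n, ∃ p, ε ≤ ‖T (f n) p‖ := by
    intro n
    by_contra! h
    exact (hfT n).not_ge ((ContinuousMap.norm_le _ hε.le).2 fun p => (h p).le)
  choose p hp using hpt
  obtain ⟨q, φ, hφ, hq⟩ := exists_strictMono_tendsto_of_wellFoundedLT p
  let ev : K → C(K, 𝕜) →L[𝕜] 𝕜 := fun x => ContinuousMap.evalCLM 𝕜 x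
  have hev : ∀ x, ‖ev x‖ ≤ 1 := fun x => ContinuousLinearMap.opNorm_le_bound _ zero_le_one
    fun g => by simpa [ev] using g.norm_coe_le_norm x
  have hlim := tendsto_zero_iff_norm_tendsto_zero.1
    ((hd.tendsto_functional hf (ev q ∘L T)).comp hφ.tendsto_atTop)
  obtain ⟨N, hN⟩ := eventually_atTop.1 (hlim.eventually_lt_const (half_pos hε))
  have hmono : StrictMono fun n => φ (n + N) := fun m n hmn => hφ (Nat.add_lt_add_right hmn N)
  have hd' : DisjointlySupported fun n => f (φ (n + N)) :=
    fun i j hij => hd _ _ (hmono.injective.ne hij)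
  -- Subtracting `ev q` makes the evaluations weak-* null. Since `T (f n)` is weakly null, its value
  -- at `q` is below `ε / 2` from `N` on, so the diagonal stays above `ε / 2`.
  refine hd'.idFactorsThrough (fun n => hf _) T (fun n => ev (p (φ (n + N))) - ev q) (M := 1 + 1)
    (fun n => (norm_sub_le _ _).trans (add_le_add (hev _) (hev _))) (fun y => ?_) (half_pos hε)
    (fun n => ?_)
  · have h := ((y.continuous.tendsto q).comp hq).comp (tendsto_add_atTop_nat N)
    simpa [ev] using h.sub_const (y q)
  · have h1 := hN (n + N) (Nat.le_add_left N n)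
    have h2 := hp (φ (n + N))
    have h3 := norm_sub_norm_le (T (f (φ (n + N))) (p (φ (n + N)))) (T (f (φ (n + N))) q)
    change ‖T (f (φ (n + N))) q‖ < ε / 2 at h1
    change ε / 2 ≤ ‖T (f (φ (n + N))) (p (φ (n + N))) - T (f (φ (n + N))) q‖
    linarith

/-- A closed two-sided ideal containing an operator through which the identity of `Z` factors
contains all operators approximable by operators factoring through `Z`. -/
theorem closedFactorIdeal_subset_of_idFactorsThrough {𝕜 Z X : Type*} [RCLike 𝕜]
    [NormedAddCommGroup Z] [NormedSpace 𝕜 Z] [NormedAddCommGroup X] [NormedSpace 𝕜 X]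
    (I : TwoSidedIdeal (X →L[𝕜] X)) (hI : IsClosed (I : Set (X →L[𝕜] X))) {T : X →L[𝕜] X}
    (hTI : T ∈ I) (hT : IdFactorsThrough 𝕜 Z T) :
    (closedFactorIdeal 𝕜 Z X X : Set (X →L[𝕜] X)) ⊆ I := by
  obtain ⟨R, S, hRS⟩ := hT
  refine hI.closure_subset_iff.2 fun W hW => ?_
  induction hW using Submodule.span_induction with
  | mem W hW =>
    obtain ⟨U, V, rfl⟩ := hW
    have : V ∘L U = (V ∘L S) * (T * (R ∘L U)) := by
      ext x
      have := congrArg V (DFunLike.congr_fun hRS (U x))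
      exact this.symm
    rw [this]
    exact I.mul_mem_left _ _ (I.mul_mem_right _ _ hTI)
  | zero => exact I.zero_mem
  | add _ _ _ _ h₁ h₂ => exact I.add_mem h₁ h₂
  | smul c W _ h =>
    have : c • W = (c • (1 : X →L[𝕜] X)) * W := by ext x; rfl
    rw [this]
    exact I.mul_mem_left _ _ h

end

theorem mainTheorem6 (𝕜 : Type*) [RCLike 𝕜] :
    (∀ T : COmegaOne 𝕜 →L[𝕜] COmegaOne 𝕜,
      ¬ IsCompactOperator T → IdFactorsThrough 𝕜 (NullSeq 𝕜) T) ∧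
    ¬ ∃ I : TwoSidedIdeal (COmegaOne 𝕜 →L[𝕜] COmegaOne 𝕜),
      IsClosed (I : Set (COmegaOne 𝕜 →L[𝕜] COmegaOne 𝕜)) ∧
      {T : COmegaOne 𝕜 →L[𝕜] COmegaOne 𝕜 | IsCompactOperator T} ⊂
        (I : Set (COmegaOne 𝕜 →L[𝕜] COmegaOne 𝕜)) ∧
      (I : Set (COmegaOne 𝕜 →L[𝕜] COmegaOne 𝕜)) ⊂
        (closedFactorIdeal 𝕜 (NullSeq 𝕜) (COmegaOne 𝕜) (COmegaOne 𝕜) :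
          Set (COmegaOne 𝕜 →L[𝕜] COmegaOne 𝕜)) := by
  have hfac : ∀ T : COmegaOne 𝕜 →L[𝕜] COmegaOne 𝕜,
      ¬ IsCompactOperator T → IdFactorsThrough 𝕜 (NullSeq 𝕜) T :=
    idFactorsThrough_nullSeq_of_not_isCompactOperator
  refine ⟨hfac, ?_⟩
  rintro ⟨I, hI, hKI, hIG⟩
  obtain ⟨T, hTI, hT⟩ := Set.exists_of_ssubset hKI
  exact hIG.not_subset (closedFactorIdeal_subset_of_idFactorsThrough I hI hTI (hfac T hT))
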